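/- Let $l\ge 1$ and let $(p_1,\dots,p_l)$ be a Cunningham chain, i.e. a sequence of odd primes with $p_i=2p_{i+1}+1$ for $1\le i<l$ (so $p_1>\cdots>p_l$), and let $n=p_1\cdots p_l$ be the corresponding Cunningham product. Let $F$ denote the Fibonacci numbers with the convention $F(1)=1$, $F(2)=2$, $F(k+1)=F(k)+F(k-1)$. Write $C_m$ for the cyclic group of order $m$. Then there are, up to isomorphism, exactly $F(l)$ groups of order $n$. They are the chains of cyclic factors $C_{p_1},\dots,C_{p_l}$ in which each two consecutive factors $C_{p_i},C_{p_{i+1}}$ are joined either by a direct product or by a non-trivial semidirect product $C_{p_i}\rtimes C_{p_{i+1}}$, with at most one semidirect product among any three consecutive factors. Precisely: call $I\subseteq\{1,\dots,l-1\}$ admissible if it contains no two consecutive integers, and for admissible $I$ and non-trivial homomorphisms $\varphi_i:C_{p_{i+1}}\to\mathrm{Aut}(C_{p_i})$ $(i\in I)$ put $$G(I,\varphi)=\prod_{j\in\{1,\dots,l\},\; j\notin I,\; j-1\notin I} C_{p_j}\;\times\;\prod_{i\in I}\bigl(C_{p_i}\rtimes_{\varphi_i}C_{p_{i+1}}\bigr).$$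 Then every group of order $n$ is isomorphic to some $G(I,\varphi)$; every $G(I,\varphi)$ has order $n$; for every admissible $I$ such homomorphisms $\varphi_i$ exist; and $G(I,\varphi)\cong G(J,\psi)$ if and only if $I=J$. -/

import Mathlib

universe u

/-- The cyclic group of order `m`, written multiplicatively. -/
abbrev Cyc (m : ℕ) : Type := Multiplicative (ZMod m)

/-- `(p 1, …, p l)` is a Cunningham chain of length `l`: odd primes, each consecutive pair being
related by `p i = 2 * p (i + 1) + 1` (so the primes are strictly decreasing). The values of `p`
outside `{1, …, l}` play no role. -/
structure IsCunninghamChain (l : ℕ) (p : ℕ → ℕ) : Prop where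
  one_le : 1 ≤ l
  prime : ∀ i ∈ Finset.Icc 1 l, (p i).Prime
  odd : ∀ i ∈ Finset.Icc 1 l, Odd (p i)
  step : ∀ i ∈ Finset.Ico 1 l, p i = 2 * p (i + 1) + 1

/-- A pattern of joins for a chain of `l` factors: `i ∈ I` says that the `i`-th and the `(i+1)`-st
factor are joined by a semidirect product (`1 ≤ i < l`), `i ∉ I` that they are joined by a direct
product. No two adjacent joins are semidirect, i.e. among any three consecutive factors there is
at most one semidirect product. -/
def IsJoinPattern (l : ℕ) (I : Finset ℕ) : Prop :=
  I ⊆ Finset.Ico 1 l ∧ ∀ i ∈ I, i + 1 ∉ I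

/-- A chain of cyclic factors `Cyc (p 1), …, Cyc (p l)`: a pattern of joins, together with, for
every semidirect join, a nontrivial action of `Cyc (p (i + 1))` on `Cyc (p i)`. -/
structure CyclicChain (l : ℕ) (p : ℕ → ℕ) where
  semi : Finset ℕ
  isJoinPattern : IsJoinPattern l semi
  action : ∀ i : semi, Cyc (p (i + 1)) →* MulAut (Cyc (p i))
  action_ne_one : ∀ i : semi, action i ≠ 1

/-- The indices of the factors of the chain that are joined directly to all their neighbours. -/
def CyclicChain.free {l : ℕ} {p : ℕ → ℕ} (c : CyclicChain l p) : Finset ℕ :=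
  {j ∈ Finset.Icc 1 l | j ∉ c.semi ∧ ∀ i ∈ c.semi, i + 1 ≠ j}

/-- The group given by a chain: since no two adjacent joins are semidirect, it is the direct product
of the factors `Cyc (p j)` joined directly to all their neighbours, and of the semidirect products
`Cyc (p i) ⋊ Cyc (p (i + 1))`, one for each semidirect join. -/
abbrev CyclicChain.toGroup {l : ℕ} {p : ℕ → ℕ} (c : CyclicChain l p) : Type :=
  (∀ j : c.free, Cyc (p j)) × (∀ i : c.semi, Cyc (p i) ⋊[c.action i] Cyc (p (i + 1)))

/-- Isomorphism of groups of order `n`. -/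
def groupIsoSetoid (n : ℕ) : Setoid {G : GrpCat.{u} // Nat.card G = n} where
  r G H := Nonempty (G.1 ≃* H.1)
  iseqv :=
    { refl := fun _ => ⟨MulEquiv.refl _⟩
      symm := fun ⟨e⟩ => ⟨e.symm⟩
      trans := fun ⟨e⟩ ⟨f⟩ => ⟨e.trans f⟩ }

/-- The isomorphism classes of groups of order `n`. -/
def GroupIsoClass (n : ℕ) : Type (u + 1) := Quotient (groupIsoSetoid.{u} n)

/-! Since `n` is squarefree, a group of order `n` is `N ⋊ H` with `N` and `H` cyclic
(`exists_homs_of_squarefree`). Choose a subgroup of each order `p i` inside `N` or `H`: those in `N`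
are normal, and two inside the same factor commute. Elements of order `p j` act on a normal subgroup
of order `p i` through a group of order `p i - 1`, which is `2 * p (i + 1)` for `i < l`, so
nontrivially only if `j = i + 1` (`coprime_sub_one`, `commute_of_normal_range`). Hence only pairs
`(i, i + 1)` with the first subgroup in `N` and the second in `H` can fail to commute, and two such
pairs are never adjacent. Multiplying the subgroups together gives the isomorphism with a chain
(`exists_cyclicChain_of_homs`). The pattern fixes the group because `Aut (Cyc (p i))` is cyclic, and
is recovered from noncommuting elements of prime order (`mem_semi_iff`). So the classes are counted
by patterns, which satisfy the Fibonacci recurrence. -/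

/-! ### Counting the patterns of joins. -/

/-- Patterns of joins as a finset. -/
def joinPatterns (l : ℕ) : Finset (Finset ℕ) :=
  {I ∈ (Finset.Ico 1 l).powerset | ∀ i ∈ I, i + 1 ∉ I}

theorem mem_joinPatterns {l : ℕ} {I : Finset ℕ} : I ∈ joinPatterns l ↔ IsJoinPattern l I := by
  simp [joinPatterns, IsJoinPattern]

/-- Split by whether the last join `l + 1` is semidirect; if it is, `l` is excluded and the rest is
a pattern for `l` factors. -/
theorem joinPatterns_succ_succ (l : ℕ) :
    joinPatterns (l + 2) = joinPatterns (l + 1) ∪ (joinPatterns l).image (insert (l + 1)) := by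
  ext I
  simp only [Finset.mem_union, Finset.mem_image, mem_joinPatterns]
  constructor
  · rintro ⟨h1, h2⟩
    by_cases hI : l + 1 ∈ I
    · right
      refine ⟨I.erase (l + 1), ⟨fun i hi => ?_, fun i hi hi' => ?_⟩, Finset.insert_erase hI⟩
      · obtain ⟨hne, hiI⟩ := Finset.mem_erase.1 hi
        have := Finset.mem_Ico.1 (h1 hiI)
        have : i ≠ l := by rintro rfl; exact h2 _ hiI hI
        exact Finset.mem_Ico.2 (by omega)
      · exact h2 i (Finset.mem_of_mem_erase hi) (Finset.mem_of_mem_erase hi')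
    · left
      refine ⟨fun i hi => ?_, h2⟩
      have := Finset.mem_Ico.1 (h1 hi)
      have : i ≠ l + 1 := by rintro rfl; exact hI hi
      exact Finset.mem_Ico.2 (by omega)
  · rintro (⟨h1, h2⟩ | ⟨J, ⟨h1, h2⟩, rfl⟩)
    · exact ⟨h1.trans (Finset.Ico_subset_Ico_right (by omega)), h2⟩
    · have key : ∀ i ∈ J, 1 ≤ i ∧ i < l := fun i hi => Finset.mem_Ico.1 (h1 hi)
      refine ⟨fun i hi => ?_, fun i hi hi' => ?_⟩
      · rcases Finset.mem_insert.1 hi with rfl | hi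
        · simp
        · have := key i hi
          exact Finset.mem_Ico.2 (by omega)
      · rcases Finset.mem_insert.1 hi with rfl | hi <;>
          rcases Finset.mem_insert.1 hi' with h | hi'
        · omega
        · have := key _ hi'
          omega
        · have := key _ hi
          omega
        · exact h2 i hi hi'

theorem card_joinPatterns (l : ℕ) : (joinPatterns l).card = Nat.fib (l + 1) := by
  induction l using Nat.twoStepInduction with
  | zero => decide
  | one => decide
  | more l h0 h1 =>
    have key : ∀ {k I i}, I ∈ joinPatterns k → i ∈ I → i < k := fun hI hi =>
      (Finset.mem_Ico.1 ((mem_joinPatterns.1 hI).1 hi)).2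
    rw [joinPatterns_succ_succ, Finset.card_union_of_disjoint, Finset.card_image_of_injOn, h0, h1,
      Nat.fib_add_two (n := l + 1), add_comm]
    · intro I hI J hJ h
      have hI' : l + 1 ∉ I := fun h => by have := key hI h; omega
      have hJ' : l + 1 ∉ J := fun h => by have := key hJ h; omega
      rw [← Finset.erase_insert hI', ← Finset.erase_insert hJ']
      exact congrArg (Finset.erase · (l + 1)) h
    · rw [Finset.disjoint_left]
      rintro I hI hI'
      obtain ⟨J, -, rfl⟩ := Finset.mem_image.1 hI'
      have := key hI (Finset.mem_insert_self _ _)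
      omega

/-! ### Arithmetic of Cunningham chains. -/

namespace IsCunninghamChain

variable {l : ℕ} {p : ℕ → ℕ}

theorem lt_of_lt (hp : IsCunninghamChain l p) {i j : ℕ} (hi : 1 ≤ i) (hij : i < j) (hj : j ≤ l) :
    p j < p i := by
  induction j, hij using Nat.le_induction with
  | base =>
    have := hp.step i (Finset.mem_Ico.2 (by omega))
    show p (i + 1) < p i
    omega
  | succ j hij ih =>
    have h1 := ih (by omega)
    have h2 := hp.step j (Finset.mem_Ico.2 ⟨by omega, by omega⟩)
    omega

theorem injOn (hp : IsCunninghamChain l p) : Set.InjOn p (Finset.Icc 1 l) := by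
  intro i hi j hj h
  simp only [Finset.coe_Icc, Set.mem_Icc] at hi hj
  rcases lt_trichotomy i j with hij | hij | hij
  · have := hp.lt_of_lt hi.1 hij hj.2
    omega
  · exact hij
  · have := hp.lt_of_lt hj.1 hij hi.2
    omega

theorem coprime (hp : IsCunninghamChain l p) {i j : ℕ} (hi : i ∈ Finset.Icc 1 l)
    (hj : j ∈ Finset.Icc 1 l) (hij : i ≠ j) : (p i).Coprime (p j) :=
  (Nat.coprime_primes (hp.prime i hi) (hp.prime j hj)).2 fun h => hij (hp.injOn hi hj h)

theorem coprime_sub_one (hp : IsCunninghamChain l p) {i j : ℕ} (hi : i ∈ Finset.Icc 1 l)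
    (hj : j ∈ Finset.Icc 1 l) (hij : j ≠ i + 1) : (p j).Coprime (p i - 1) := by
  have hi' := Finset.mem_Icc.1 hi
  have hj' := Finset.mem_Icc.1 hj
  rcases hi'.2.lt_or_eq with h | h
  · have h1 := hp.step i (Finset.mem_Ico.2 (by omega))
    rw [h1, Nat.add_sub_cancel]
    exact Nat.Coprime.mul_right (hp.odd j hj).coprime_two_right
      (hp.coprime hj (Finset.mem_Icc.2 (by omega)) hij)
  -- Here `i = l`, and `p l - 1` is positive and smaller than every prime of the chain.
  · have h2 := (hp.prime i hi).two_le
    have h3 : p i ≤ p j := by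
      rcases hj'.2.lt_or_eq with h4 | h4
      · exact (hp.lt_of_lt hj'.1 h4 le_rfl).le.trans' (by rw [h])
      · rw [h, h4]
    exact (Nat.coprime_of_lt_prime (by omega) (by omega) (hp.prime j hj))

theorem squarefree_prod (hp : IsCunninghamChain l p) :
    Squarefree (∏ i ∈ Finset.Icc 1 l, p i) := by
  refine Finset.squarefree_prod_of_pairwise_isCoprime ?_ fun i hi => (hp.prime i hi).squarefree
  intro i hi j hj hij
  exact Nat.coprime_iff_isRelPrime.1 (hp.coprime hi hj hij)

theorem prod_ne_zero (hp : IsCunninghamChain l p) : ∏ i ∈ Finset.Icc 1 l, p i ≠ 0 :=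
  Finset.prod_ne_zero_iff.2 fun i hi => (hp.prime i hi).ne_zero

end IsCunninghamChain

/-! ### Cyclic groups of prime order and their actions. -/

section

variable {G : Type*} [Group G]

theorem exists_injective_hom_cyc {x : G} {m : ℕ} (hx : orderOf x = m) :
    ∃ f : Cyc m →* G, Function.Injective f := by
  have e := zmodCyclicMulEquiv (G := Subgroup.zpowers x) inferInstance
  rw [Nat.card_zpowers, hx] at e
  exact ⟨(Subgroup.zpowers x).subtype.comp e.toMonoidHom,
    Subtype.val_injective.comp e.injective⟩

theorem exists_injective_hom_cyc_of_dvd_card [Finite G] {m : ℕ} (hm : m.Prime)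
    (h : m ∣ Nat.card G) : ∃ f : Cyc m →* G, Function.Injective f := by
  have := Fact.mk hm
  obtain ⟨x, hx⟩ := exists_prime_orderOf_dvd_card' m h
  exact exists_injective_hom_cyc hx

theorem Cyc.card (m : ℕ) : Nat.card (Cyc m) = m := Nat.card_zmod m

theorem Cyc.pow_eq_one {m : ℕ} (x : Cyc m) : x ^ m = 1 := by
  have := pow_card_eq_one' (x := x)
  rwa [Cyc.card] at this

theorem Cyc.injective_of_ne_one {m : ℕ} (hm : m.Prime) {f : Cyc m →* G} (hf : f ≠ 1) :
    Function.Injective f := by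
  have : Fact (Nat.card (Cyc m)).Prime := ⟨by rwa [Cyc.card]⟩
  rw [← MonoidHom.ker_eq_bot_iff]
  refine f.ker.eq_bot_or_eq_top_of_prime_card.resolve_right fun h => hf ?_
  ext x
  exact (MonoidHom.mem_ker (f := f)).1 (by rw [h]; trivial)

theorem card_mulAut_of_prime_card [Finite G] {m : ℕ} (hm : m.Prime) (h : Nat.card G = m) :
    Nat.card (MulAut G) = m - 1 := by
  have := Fact.mk hm
  have : IsCyclic G := isCyclic_of_prime_card h
  rw [IsCyclic.card_mulAut, h, Nat.totient_prime hm]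

/-- A normal subgroup of prime order `m` is centralized by elements of order prime to `m - 1`. -/
theorem commute_of_normal_range {m k : ℕ} (hm : m.Prime) (f : Cyc m →* G)
    (hf : Function.Injective f) (hn : f.range.Normal) {g : G} (hg : g ^ k = 1)
    (hk : k.Coprime (m - 1)) (x : Cyc m) : Commute (f x) g := by
  have := hm.ne_zero
  have : NeZero m := ⟨this⟩
  have hcard : Nat.card f.range = m := by
    rw [← Nat.card_congr (MonoidHom.ofInjective hf).toEquiv, Cyc.card]
  have : Finite f.range := Nat.finite_of_card_ne_zero (by rw [hcard]; exact hm.ne_zero)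
  -- The order of conjugation by `g` divides both `m - 1` and `k`, so it is 1.
  have h1 : orderOf (MulAut.conjNormal (H := f.range) g) ∣ m - 1 := by
    rw [← card_mulAut_of_prime_card hm hcard]; exact orderOf_dvd_natCard _
  have h2 : orderOf (MulAut.conjNormal (H := f.range) g) ∣ k :=
    orderOf_dvd_of_pow_eq_one (by rw [← map_pow, hg, map_one])
  have h3 := orderOf_eq_one_iff.1 (Nat.eq_one_of_dvd_coprimes hk h2 h1)
  have h4 := MulAut.conjNormal_apply (H := f.range) g ⟨f x, x, rfl⟩
  rw [h3] at h4
  exact (eq_mul_inv_iff_mul_eq.1 h4)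

/-- Two nontrivial actions of a cyclic group of prime order on another one give isomorphic
semidirect products. -/
theorem nonempty_semidirectProduct_mulEquiv {m k : ℕ} (hm : m.Prime) (hk : k.Prime)
    {φ ψ : Cyc k →* MulAut (Cyc m)} (hφ : φ ≠ 1) (hψ : ψ ≠ 1) :
    Nonempty (Cyc m ⋊[φ] Cyc k ≃* Cyc m ⋊[ψ] Cyc k) := by
  have : Fact m.Prime := ⟨hm⟩
  have : NeZero k := ⟨hk.ne_zero⟩
  have hφ' := Cyc.injective_of_ne_one hk hφ
  have hψ' := Cyc.injective_of_ne_one hk hψ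
  have hcyc : IsCyclic (MulAut (Cyc m)) := by
    have e := IsCyclic.mulAutMulEquiv (Cyc m)
    rw [Cyc.card] at e
    exact isCyclic_of_injective e.toMonoidHom e.injective
  -- Both ranges have `k` elements, all solutions of `x ^ k = 1`, and a cyclic group has at most `k`
  -- of these. So `φ` and `ψ` differ by an automorphism `α` of `Cyc k`.
  have hr : φ.range = ψ.range := by
    have h : ∀ χ : Cyc k →* MulAut (Cyc m), Function.Injective χ →
        (χ.range : Set (MulAut (Cyc m))) = {x | x ^ k = 1} := by
      intro χ hχ
      classical
      have := Fintype.ofFinite (MulAut (Cyc m))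
      refine Set.eq_of_subset_of_ncard_le ?_ ?_ (Set.toFinite _)
      · rintro _ ⟨x, rfl⟩
        rw [Set.mem_ofPred_eq, ← map_pow, Cyc.pow_eq_one, map_one]
      · calc _ = ({x | x ^ k = 1} : Finset (MulAut (Cyc m))).card := by
              rw [← Set.ncard_coe_finset]; simp
          _ ≤ k := IsCyclic.card_pow_eq_one_le hk.pos
          _ = Nat.card χ.range := by
              rw [← Nat.card_congr (MonoidHom.ofInjective hχ).toEquiv, Cyc.card]
    exact SetLike.coe_injective ((h φ hφ').trans (h ψ hψ').symm)
  let α : Cyc k ≃* Cyc k := (MonoidHom.ofInjective hφ').trans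
    ((MulEquiv.subgroupCongr hr).trans (MonoidHom.ofInjective hψ').symm)
  refine ⟨SemidirectProduct.congr (MulEquiv.refl _) α fun c => ?_⟩
  have : ψ (α c) = φ c := by
    have := MonoidHom.apply_ofInjective_symm hψ' (MulEquiv.subgroupCongr hr (MonoidHom.ofInjective hφ' c))
    exact this
  rw [this]
  rfl

end

/-! ### Groups of squarefree order. -/

/-- A group of squarefree order contains elements of every prime order `p i` dividing it, those with
`i ∈ A` spanning normal subgroups, those with both or neither of `i`, `j` in `A` commuting. -/
theorem exists_homs_of_squarefree {G : Type*} [Group G] [Finite G] (hG : Squarefree (Nat.card G))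
    (s : Finset ℕ) (p : ℕ → ℕ) (hp : ∀ i ∈ s, (p i).Prime ∧ p i ∣ Nat.card G) :
    ∃ (f : ∀ i, Cyc (p i) →* G) (A : Set ℕ), (∀ i ∈ s, Function.Injective (f i)) ∧
      (∀ i ∈ s, i ∈ A → (f i).range.Normal) ∧
      ∀ i ∈ s, ∀ j ∈ s, (i ∈ A ↔ j ∈ A) → ∀ x y, Commute (f i x) (f j y) := by
  classical
  obtain ⟨N, H, φ, e, hH, hN, -⟩ := isZGroup_iff_exists_mulEquiv.1 (IsZGroup.of_squarefree hG)
  have hcard : Nat.card G = Nat.card N * Nat.card H := by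
    rw [Nat.card_congr e.toEquiv, SemidirectProduct.card]
  let ι : N →* G := e.symm.toMonoidHom.comp SemidirectProduct.inl
  let κ : H →* G := e.symm.toMonoidHom.comp SemidirectProduct.inr
  have hι : Function.Injective ι := e.symm.injective.comp SemidirectProduct.inl_injective
  have hκ : Function.Injective κ := e.symm.injective.comp SemidirectProduct.inr_injective
  have key : ∀ i, ∃ f : Cyc (p i) →* G, i ∈ s → Function.Injective f ∧
      (p i ∣ Nat.card N → ∃ g : Cyc (p i) →* N, f = ι.comp g) ∧
      (¬ p i ∣ Nat.card N → ∃ g : Cyc (p i) →* H, f = κ.comp g) := by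
    intro i
    by_cases hi : i ∈ s
    · by_cases h : p i ∣ Nat.card N
      · obtain ⟨g, hg⟩ := exists_injective_hom_cyc_of_dvd_card (hp i hi).1 h
        exact ⟨ι.comp g, fun _ => ⟨hι.comp hg, fun _ => ⟨g, rfl⟩, fun h' => absurd h h'⟩⟩
      · obtain ⟨g, hg⟩ := exists_injective_hom_cyc_of_dvd_card (hp i hi).1
          (((hp i hi).1.dvd_mul.1 (hcard ▸ (hp i hi).2)).resolve_left h)
        exact ⟨κ.comp g, fun _ => ⟨hκ.comp hg, fun h' => absurd h' h, fun _ => ⟨g, rfl⟩⟩⟩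
    · exact ⟨1, fun h => absurd h hi⟩
  choose f hf using key
  refine ⟨f, {i | p i ∣ Nat.card N}, fun i hi => (hf i hi).1, fun i hi hiA => ?_,
    fun i hi j hj hij x y => ?_⟩
  · obtain ⟨g, hg⟩ := (hf i hi).2.1 hiA
    refine ⟨?_⟩
    rintro _ ⟨x, rfl⟩ b
    obtain ⟨a, rfl⟩ := e.symm.surjective b
    -- Every endomorphism of the cyclic group `N` is a power map, so each of its subgroups is stable
    -- under conjugation by `a`.
    obtain ⟨k, hk⟩ := MonoidHom.map_cyclic (MulAut.conj a.left * φ a.right).toMonoidHom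
    have h : a * SemidirectProduct.inl (g x) * a⁻¹ = SemidirectProduct.inl (g x ^ k) := by
      rw [← hk]
      ext <;> simp
    refine ⟨x ^ k, ?_⟩
    have h' := congrArg e.symm h
    rw [map_mul, map_mul, map_inv] at h'
    rw [hg, MonoidHom.comp_apply, map_zpow]
    exact h'.symm
  · by_cases hiA : p i ∣ Nat.card N
    · obtain ⟨g, hg⟩ := (hf i hi).2.1 hiA
      obtain ⟨g', hg'⟩ := (hf j hj).2.1 (hij.1 hiA)
      rw [hg, hg']
      let := hN.commGroup
      exact (Commute.all (g x) (g' y)).map ι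
    · obtain ⟨g, hg⟩ := (hf i hi).2.2 hiA
      obtain ⟨g', hg'⟩ := (hf j hj).2.2 (fun h => hiA (hij.2 h))
      rw [hg, hg']
      let := hH.commGroup
      exact (Commute.all (g x) (g' y)).map κ

/-! ### From groups to chains. -/

theorem CyclicChain.mem_free {l : ℕ} {p : ℕ → ℕ} (c : CyclicChain l p) {j : ℕ} :
    j ∈ c.free ↔ j ∈ Finset.Icc 1 l ∧ j ∉ c.semi ∧ ∀ i ∈ c.semi, i + 1 ≠ j := by
  simp [CyclicChain.free]

theorem CyclicChain.mem_Icc {l : ℕ} {p : ℕ → ℕ} (c : CyclicChain l p) {i : ℕ}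
    (hi : i ∈ c.semi) : i ∈ Finset.Icc 1 l ∧ i + 1 ∈ Finset.Icc 1 l := by
  have := Finset.mem_Ico.1 (c.isJoinPattern.1 hi)
  simp only [Finset.mem_Icc]
  omega

theorem CyclicChain.card_toGroup {l : ℕ} {p : ℕ → ℕ} (c : CyclicChain l p) :
    Nat.card c.toGroup = ∏ i ∈ Finset.Icc 1 l, p i := by
  have h1 : Finset.Icc 1 l = c.free ∪ (c.semi ∪ c.semi.image (· + 1)) := by
    ext i
    simp only [Finset.mem_union, Finset.mem_image, c.mem_free]
    constructor
    · intro h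
      by_contra! h'
      exact h'.1 h h'.2.1 |>.elim fun j hj => h'.2.2 j hj.1 hj.2
    · rintro (h | h | ⟨j, h, rfl⟩)
      exacts [h.1, (c.mem_Icc h).1, (c.mem_Icc h).2]
  have h2 : Disjoint c.semi (c.semi.image (· + 1)) := by
    rw [Finset.disjoint_right]
    intro i hi
    obtain ⟨j, hj, rfl⟩ := Finset.mem_image.1 hi
    exact c.isJoinPattern.2 j hj
  have h3 : Disjoint c.free (c.semi ∪ c.semi.image (· + 1)) := by
    rw [Finset.disjoint_left]
    intro i hi
    simp only [Finset.mem_union, Finset.mem_image, not_or, not_exists, not_and]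
    exact ⟨(c.mem_free.1 hi).2.1, (c.mem_free.1 hi).2.2⟩
  rw [h1, Finset.prod_union h3, Finset.prod_union h2, Finset.prod_image (by simp),
    ← Finset.prod_mul_distrib, Nat.card_prod, Nat.card_pi, Nat.card_pi]
  simp only [SemidirectProduct.card, Cyc.card]
  rw [Finset.prod_coe_sort c.free p, Finset.prod_coe_sort c.semi fun i => p i * p (i + 1)]

/-- A group whose order is the product of the chain, with subgroups of the orders `p i` that
commute, apart from the pairs `(i, i + 1)` with `i ∈ I`, is given by a chain of pattern `I`. -/
theorem exists_cyclicChain_of_homs {l : ℕ} {p : ℕ → ℕ} (hp : IsCunninghamChain l p)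
    {G : Type*} [Group G] (hG : Nat.card G = ∏ i ∈ Finset.Icc 1 l, p i)
    (I : Finset ℕ) (hI : IsJoinPattern l I) (f : ∀ i, Cyc (p i) →* G)
    (hf : ∀ i ∈ Finset.Icc 1 l, Function.Injective (f i))
    (hn : ∀ i ∈ I, (f i).range.Normal)
    (hnc : ∀ i ∈ I, ¬ ∀ x y, Commute (f i x) (f (i + 1) y))
    (hc : ∀ i ∈ Finset.Icc 1 l, ∀ j ∈ Finset.Icc 1 l, (i ∈ I → j ≠ i + 1) → (j ∈ I → i ≠ j + 1) →
      ∀ x y, Commute (f i x) (f j y)) :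
    ∃ c : CyclicChain l p, Nonempty (G ≃* c.toGroup) := by
  classical
  have hI' : ∀ i ∈ I, i ∈ Finset.Icc 1 l ∧ i + 1 ∈ Finset.Icc 1 l := fun i hi => by
    have := Finset.mem_Ico.1 (hI.1 hi)
    simp only [Finset.mem_Icc]
    omega
  have key : ∀ i : I, ∃ φ : Cyc (p (i + 1)) →* MulAut (Cyc (p i)),
      ∀ y x, f i (φ y x) = f (i + 1) y * f i x * (f (i + 1) y)⁻¹ := by
    intro i
    have := hn i i.2
    let e := MonoidHom.ofInjective (hf i (hI' i i.2).1)
    refine ⟨(MulAut.congr e.symm).toMonoidHom.comp (MulAut.conjNormal.comp (f (i + 1))),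
      fun y x => ?_⟩
    have h := MonoidHom.apply_ofInjective_symm (hf i (hI' i i.2).1)
      (MulAut.conjNormal (f (i + 1) y) (e x))
    rw [MulAut.conjNormal_apply] at h
    exact h
  choose φ hφ using key
  let c : CyclicChain l p := ⟨I, hI, φ, fun i h => hnc i i.2 fun x y => by
    have := hφ i y x
    rw [h] at this
    exact eq_mul_inv_iff_mul_eq.1 this⟩
  let F : ∀ i : c.semi, Cyc (p i) ⋊[c.action i] Cyc (p (i + 1)) →* G := fun i =>
    SemidirectProduct.lift (f i) (f (i + 1)) fun y => MonoidHom.ext fun x => hφ i y x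
  have hF : ∀ i z, F i z = f i z.left * f (i + 1) z.right := fun i z => rfl
  have h1 : Pairwise fun i j : c.free => ∀ x y, Commute (f i x) (f j y) := fun i j _ =>
    hc i (c.mem_free.1 i.2).1 j (c.mem_free.1 j.2).1 (fun h => absurd h (c.mem_free.1 i.2).2.1)
      (fun h => absurd h (c.mem_free.1 j.2).2.1)
  have hne : ∀ i ∈ I, ∀ j ∈ I, i ≠ j + 1 := fun i hi j hj h => hI.2 j hj (h ▸ hi)
  have h2 : Pairwise fun i j : c.semi => ∀ x y, Commute (F i x) (F j y) := by
    intro i j hij x y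
    have hij' : (i : ℕ) ≠ j := fun h => hij (Subtype.ext h)
    have hi := hI' i i.2
    have hj := hI' j j.2
    have hI2 := hI.2
    rw [hF, hF]
    refine Commute.mul_left (Commute.mul_right ?_ ?_) (Commute.mul_right ?_ ?_)
    · exact hc i hi.1 j hj.1 (fun _ => hne j j.2 i i.2) (fun _ => hne i i.2 j j.2) _ _
    · exact hc i hi.1 _ hj.2 (fun _ => by omega) (fun h => absurd h (hI2 j j.2)) _ _
    · exact hc _ hi.2 j hj.1 (fun h => absurd h (hI2 i i.2)) (fun _ => by omega) _ _
    · exact hc _ hi.2 _ hj.2 (fun h => absurd h (hI2 i i.2)) (fun h => absurd h (hI2 j j.2)) _ _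
  let Φ : (∀ j : c.free, Cyc (p j)) →* G :=
    MonoidHom.noncommPiCoprod (fun j : c.free => f j) h1
  let Ψ : (∀ i : c.semi, Cyc (p i) ⋊[c.action i] Cyc (p (i + 1))) →* G :=
    MonoidHom.noncommPiCoprod F h2
  have h3 : ∀ x y, Commute (Φ x) (Ψ y) := by
    intro x y
    refine MonoidHom.commute_noncommPiCoprod _ (fun i z => Commute.symm ?_) y
    refine MonoidHom.commute_noncommPiCoprod _ (fun j w => ?_) x
    obtain ⟨hj1, hj2, hj3⟩ := c.mem_free.1 j.2
    have hi := hI' i i.2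
    rw [hF]
    refine Commute.mul_left ?_ ?_
    · exact hc _ hi.1 _ hj1 (fun _ h => hj3 i i.2 h.symm) (fun h => absurd h hj2) _ _
    · exact hc _ hi.2 _ hj1 (fun h => absurd h (hI.2 i i.2)) (fun h => absurd h hj2) _ _
  let Θ : c.toGroup →* G := Φ.noncommCoprod Ψ h3
  have hG0 : Nat.card G ≠ 0 := by rw [hG]; exact hp.prod_ne_zero
  have hfin : Finite G := Nat.finite_of_card_ne_zero hG0
  have hfree : ∀ j (hj : j ∈ c.free), (f j).range ≤ Θ.range := by
    rintro j hj _ ⟨x, rfl⟩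
    refine ⟨(Pi.mulSingle ⟨j, hj⟩ x, 1), ?_⟩
    simp [Θ, Φ, MonoidHom.noncommCoprod_apply]
  have hsemi : ∀ i (hi : i ∈ c.semi), (f i).range ≤ Θ.range ∧ (f (i + 1)).range ≤ Θ.range := by
    refine fun i hi => ⟨?_, ?_⟩
    · rintro _ ⟨x, rfl⟩
      refine ⟨(1, Pi.mulSingle ⟨i, hi⟩ (SemidirectProduct.inl x)), ?_⟩
      simp [Θ, Ψ, MonoidHom.noncommCoprod_apply, hF]
    · rintro _ ⟨x, rfl⟩
      refine ⟨(1, Pi.mulSingle ⟨i, hi⟩ (SemidirectProduct.inr x)), ?_⟩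
      simp [Θ, Ψ, MonoidHom.noncommCoprod_apply, hF]
  have hall : ∀ i ∈ Finset.Icc 1 l, (f i).range ≤ Θ.range := by
    intro i hi
    by_cases h : i ∈ c.free
    · exact hfree i h
    · by_cases h' : i ∈ c.semi
      · exact (hsemi i h').1
      · obtain ⟨j, hj, rfl⟩ : ∃ j ∈ c.semi, j + 1 = i := by
          by_contra! h''
          exact h (c.mem_free.2 ⟨hi, h', h''⟩)
        exact (hsemi j hj).2
  -- The range contains subgroups of the pairwise coprime orders `p i`, so `Θ` is onto; equality of
  -- orders then gives bijectivity.
  have hdvd : Nat.card G ∣ Nat.card Θ.range := by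
    rw [hG]
    refine Finset.prod_dvd_of_isRelPrime
      (fun i hi j hj hij => Nat.coprime_iff_isRelPrime.1 (hp.coprime hi hj hij)) fun i hi => ?_
    have := Subgroup.card_dvd_of_le (hall i hi)
    rwa [← Nat.card_congr (MonoidHom.ofInjective (hf i hi)).toEquiv, Cyc.card] at this
  have htop : Θ.range = ⊤ := Subgroup.eq_top_of_le_card _ (Nat.le_of_dvd Nat.card_pos hdvd)
  have hbij : Function.Bijective Θ := by
    have : Finite c.toGroup := Nat.finite_of_card_ne_zero (by rw [c.card_toGroup, ← hG]; exact hG0)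
    rw [Nat.bijective_iff_surjective_and_card]
    exact ⟨MonoidHom.range_eq_top.1 htop, by rw [hG, c.card_toGroup]⟩
  exact ⟨c, ⟨(MulEquiv.ofBijective Θ hbij).symm⟩⟩

theorem exists_mulEquiv_cyclicChain {l : ℕ} {p : ℕ → ℕ} (hp : IsCunninghamChain l p)
    {G : Type*} [Group G] (hG : Nat.card G = ∏ i ∈ Finset.Icc 1 l, p i) :
    ∃ c : CyclicChain l p, Nonempty (G ≃* c.toGroup) := by
  classical
  have hfin : Finite G := Nat.finite_of_card_ne_zero (by rw [hG]; exact hp.prod_ne_zero)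
  obtain ⟨f, A, hf, hn, hc⟩ := exists_homs_of_squarefree (hG ▸ hp.squarefree_prod)
    (Finset.Icc 1 l) p fun i hi => ⟨hp.prime i hi, hG ▸ Finset.dvd_prod_of_mem p hi⟩
  have hcop : ∀ i ∈ Finset.Icc 1 l, ∀ j ∈ Finset.Icc 1 l, i ∈ A → j ≠ i + 1 →
      ∀ x y, Commute (f i x) (f j y) := fun i hi j hj hiA hij x y =>
    commute_of_normal_range (hp.prime i hi) (f i) (hf i hi) (hn i hi hiA)
      (by rw [← map_pow, Cyc.pow_eq_one, map_one]) (hp.coprime_sub_one hi hj hij) x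
  let I : Finset ℕ := {i ∈ Finset.Ico 1 l | ¬ ∀ x y, Commute (f i x) (f (i + 1) y)}
  have hI : ∀ i, i ∈ I ↔ i ∈ Finset.Ico 1 l ∧ ¬ ∀ x y, Commute (f i x) (f (i + 1) y) := by
    simp [I]
  have hIcc : ∀ i ∈ Finset.Ico 1 l, i ∈ Finset.Icc 1 l ∧ i + 1 ∈ Finset.Icc 1 l := fun i hi => by
    have := Finset.mem_Ico.1 hi
    simp only [Finset.mem_Icc]
    omega
  have hIA : ∀ i ∈ I, i ∈ A ∧ i + 1 ∉ A := by
    intro i hi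
    obtain ⟨hi, hnc⟩ := (hI i).1 hi
    have hi' := hIcc i hi
    -- If only `i + 1` were in `A`, its normal subgroup would be centralized by elements of order `p
    -- i`, as `i ≠ (i + 1) + 1`.
    have : i ∈ A := by
      by_contra hiA
      by_cases h : i + 1 ∈ A
      · exact hnc fun x y => (hcop _ hi'.2 _ hi'.1 h (by omega) y x).symm
      · exact hnc (hc _ hi'.1 _ hi'.2 (iff_of_false hiA h))
    exact ⟨this, fun h => hnc (hc _ hi'.1 _ hi'.2 (iff_of_true this h))⟩
  refine exists_cyclicChain_of_homs hp hG I ⟨fun i hi => ((hI i).1 hi).1, fun i hi hi' =>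
    (hIA i hi).2 (hIA _ hi').1⟩ f hf (fun i hi => hn i (hIcc i ((hI i).1 hi).1).1 (hIA i hi).1)
    (fun i hi => ((hI i).1 hi).2) ?_
  have key : ∀ i ∈ Finset.Icc 1 l, ∀ j ∈ Finset.Icc 1 l, i ∈ A → (i ∈ I → j ≠ i + 1) →
      ∀ x y, Commute (f i x) (f j y) := by
    intro i hi j hj hiA hij
    by_cases h : j = i + 1
    · subst h
      by_contra hnc
      simp only [Finset.mem_Icc] at hi hj
      exact hij ((hI i).2 ⟨Finset.mem_Ico.2 (by omega), hnc⟩) rfl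
    · exact hcop i hi j hj hiA h
  intro i hi j hj hij hji x y
  by_cases hiA : i ∈ A
  · exact key i hi j hj hiA hij x y
  · by_cases hjA : j ∈ A
    · exact (key j hj i hi hjA hji y x).symm
    · exact hc i hi j hj (iff_of_false hiA hjA) x y

/-! ### Existence and classification of chains. -/

theorem IsCunninghamChain.exists_cyclicChain {l : ℕ} {p : ℕ → ℕ} (hp : IsCunninghamChain l p)
    {I : Finset ℕ} (hI : IsJoinPattern l I) : ∃ c : CyclicChain l p, c.semi = I := by
  have key : ∀ i : I, ∃ φ : Cyc (p (i + 1)) →* MulAut (Cyc (p i)), φ ≠ 1 := by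
    intro i
    have hi := Finset.mem_Ico.1 (hI.1 i.2)
    have h1 := hp.prime i (Finset.mem_Icc.2 (by omega))
    have h2 := hp.prime (i + 1) (Finset.mem_Icc.2 (by omega))
    have h3 := hp.step i (hI.1 i.2)
    have : NeZero (p i) := ⟨h1.ne_zero⟩
    obtain ⟨φ, hφ⟩ := exists_injective_hom_cyc_of_dvd_card (G := MulAut (Cyc (p i))) h2 (by
      rw [card_mulAut_of_prime_card h1 (Cyc.card _), h3, Nat.add_sub_cancel]
      exact dvd_mul_left _ _)
    refine ⟨φ, ?_⟩
    rintro rfl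
    have : Fact (1 < p (i + 1)) := ⟨h2.one_lt⟩
    obtain ⟨x, hx⟩ := exists_ne (1 : Cyc (p (i + 1)))
    exact hx (hφ rfl)
  choose φ hφ using key
  exact ⟨⟨I, hI, φ, hφ⟩, rfl⟩

theorem IsCunninghamChain.nonempty_mulEquiv_of_semi_eq {l : ℕ} {p : ℕ → ℕ}
    (hp : IsCunninghamChain l p) {c d : CyclicChain l p} (h : c.semi = d.semi) :
    Nonempty (c.toGroup ≃* d.toGroup) := by
  obtain ⟨I, hI, φ, hφ⟩ := c
  obtain ⟨J, hJ, ψ, hψ⟩ := d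
  obtain rfl : I = J := h
  have key : ∀ i : I, Nonempty (Cyc (p i) ⋊[φ i] Cyc (p (i + 1)) ≃*
      Cyc (p i) ⋊[ψ i] Cyc (p (i + 1))) := fun i => by
    have hi := Finset.mem_Ico.1 (hI.1 i.2)
    exact nonempty_semidirectProduct_mulEquiv (hp.prime i (Finset.mem_Icc.2 (by omega)))
      (hp.prime (i + 1) (Finset.mem_Icc.2 (by omega))) (hφ i) (hψ i)
  exact ⟨MulEquiv.prodCongr (MulEquiv.refl _) (MulEquiv.piCongrRight fun i => (key i).some)⟩

/-- The semidirect joins of a chain are detected by the noncommuting elements of prime orders. -/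
theorem CyclicChain.mem_semi_iff {l : ℕ} {p : ℕ → ℕ} (hp : IsCunninghamChain l p)
    (c : CyclicChain l p) {i : ℕ} :
    i ∈ c.semi ↔ i ∈ Finset.Ico 1 l ∧
      ∃ x y : c.toGroup, x ^ p i = 1 ∧ y ^ p (i + 1) = 1 ∧ ¬ Commute x y := by
  classical
  constructor
  · intro hi
    refine ⟨c.isJoinPattern.1 hi, ?_⟩
    by_contra! h
    refine c.action_ne_one ⟨i, hi⟩ (MonoidHom.ext fun y => MulEquiv.ext fun x => ?_)
    let ι : (Cyc (p i) ⋊[c.action ⟨i, hi⟩] Cyc (p (i + 1))) →* c.toGroup :=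
      (MonoidHom.inr _ _).comp (MonoidHom.mulSingle
        (fun i : c.semi => Cyc (p i) ⋊[c.action i] Cyc (p (i + 1))) ⟨i, hi⟩)
    have hι : Function.Injective ι := fun a b hab =>
      Pi.mulSingle_injective (M := fun i : c.semi => Cyc (p i) ⋊[c.action i] Cyc (p (i + 1)))
        ⟨i, hi⟩ (Prod.ext_iff.1 hab).2
    have h1 := h (ι (SemidirectProduct.inl x)) (ι (SemidirectProduct.inr y))
      (by rw [← map_pow, ← map_pow, Cyc.pow_eq_one, map_one, map_one])
      (by rw [← map_pow, ← map_pow, Cyc.pow_eq_one, map_one, map_one])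
    have h2 : Commute (SemidirectProduct.inl x) (SemidirectProduct.inr y) :=
      hι (by simpa only [map_mul] using h1.eq)
    have h3 := SemidirectProduct.inl_aut (φ := c.action ⟨i, hi⟩) y x
    rw [← h2.eq, mul_assoc, ← map_mul, mul_inv_cancel, map_one, mul_one] at h3
    exact SemidirectProduct.inl_injective h3
  · rintro ⟨hi, x, y, hx, hy, hxy⟩
    by_contra hic
    have hi' : i ∈ Finset.Icc 1 l ∧ i + 1 ∈ Finset.Icc 1 l := by
      have := Finset.mem_Ico.1 hi
      simp only [Finset.mem_Icc]
      omega
    refine hxy (Prod.ext (mul_comm _ _) (funext fun k => ?_))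
    have hk := c.mem_Icc k.2
    have hki : i ≠ k := fun h => hic (h ▸ k.2)
    have hx' : (x.2 k) ^ p i = 1 := congrFun (Prod.ext_iff.1 hx).2 k
    have hy' : (y.2 k) ^ p (i + 1) = 1 := congrFun (Prod.ext_iff.1 hy).2 k
    -- The factor at `k` has order `p k * p (k + 1)`. As `i ≠ k`, it cannot contain nontrivial
    -- elements of both orders `p i` and `p (i + 1)`, so one of the two components is trivial.
    have key : ∀ (z : Cyc (p k) ⋊[c.action k] Cyc (p (k + 1))) (j : ℕ), j ∈ Finset.Icc 1 l →
        j ≠ k → j ≠ k + 1 → z ^ p j = 1 → z = 1 := by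
      intro z j hj hjk hjk' hz
      have h1 := orderOf_dvd_of_pow_eq_one hz
      have h2 := orderOf_dvd_natCard z
      rw [SemidirectProduct.card, Cyc.card, Cyc.card] at h2
      exact orderOf_eq_one_iff.1 (Nat.eq_one_of_dvd_coprimes
        ((hp.coprime hj hk.1 hjk).mul_right (hp.coprime hj hk.2 hjk')) h1 h2)
    show x.2 k * y.2 k = y.2 k * x.2 k
    by_cases h : i = k + 1
    · rw [key (y.2 k) (i + 1) hi'.2 (by omega) (by omega) hy', one_mul, mul_one]
    · rw [key (x.2 k) i hi'.1 hki h hx', one_mul, mul_one]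

theorem IsCunninghamChain.nonempty_mulEquiv_iff {l : ℕ} {p : ℕ → ℕ}
    (hp : IsCunninghamChain l p) (c d : CyclicChain l p) :
    Nonempty (c.toGroup ≃* d.toGroup) ↔ c.semi = d.semi := by
  refine ⟨fun ⟨e⟩ => ?_, hp.nonempty_mulEquiv_of_semi_eq⟩
  have key : ∀ (c d : CyclicChain l p), (c.toGroup ≃* d.toGroup) → c.semi ⊆ d.semi := by
    intro c d e i hi
    obtain ⟨hi', x, y, hx, hy, hxy⟩ := (c.mem_semi_iff hp).1 hi
    refine (d.mem_semi_iff hp).2 ⟨hi', e x, e y, by rw [← map_pow, hx, map_one],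
      by rw [← map_pow, hy, map_one], fun h => hxy (e.injective ?_)⟩
    simpa only [map_mul] using h.eq
  exact (key c d e).antisymm (key d c e.symm)

theorem IsCunninghamChain.card_groupIsoClass {l : ℕ} {p : ℕ → ℕ} (hp : IsCunninghamChain l p) :
    Nat.card (GroupIsoClass.{u} (∏ i ∈ Finset.Icc 1 l, p i)) = Nat.fib (l + 1) := by
  choose c hc using fun I : joinPatterns l =>
    hp.exists_cyclicChain (mem_joinPatterns.1 I.2)
  let Φ : joinPatterns l → GroupIsoClass.{u} (∏ i ∈ Finset.Icc 1 l, p i) := fun I =>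
    -- `toGroup` lives in `Type`; `ULift` moves it to universe `u`.
    Quotient.mk _ ⟨GrpCat.of (ULift.{u} (c I).toGroup), by
      rw [← (c I).card_toGroup]; exact Nat.card_congr Equiv.ulift⟩
  have hΦ : Function.Bijective Φ := by
    constructor
    · intro I J h
      obtain ⟨e⟩ : Nonempty (ULift.{u} (c I).toGroup ≃* ULift.{u} (c J).toGroup) :=
        Quotient.exact h
      have := (hp.nonempty_mulEquiv_iff (c I) (c J)).1
        ⟨MulEquiv.ulift.symm.trans (e.trans MulEquiv.ulift)⟩
      rw [hc, hc] at this
      exact Subtype.ext this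
    · intro q
      induction q using Quotient.inductionOn with
      | h G =>
        obtain ⟨d, ⟨e⟩⟩ := exists_mulEquiv_cyclicChain hp G.2
        let I : joinPatterns l := ⟨d.semi, mem_joinPatterns.2 d.isJoinPattern⟩
        obtain ⟨e'⟩ := (hp.nonempty_mulEquiv_iff (c I) d).2 (hc I)
        exact ⟨I, Quotient.sound ⟨MulEquiv.ulift.trans (e'.trans e.symm)⟩⟩
  rw [← Nat.card_congr (Equiv.ofBijective Φ hΦ), Nat.card_eq_fintype_card, Fintype.card_coe,
    card_joinPatterns]

/-- The Fibonacci number `F(l)` with the convention `F(1) = 1`, `F(2) = 2` is `Nat.fib (l + 1)`. -/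
theorem mainTheorem5 (l : ℕ) (p : ℕ → ℕ) (hp : IsCunninghamChain l p)
    (n : ℕ) (hn : n = ∏ i ∈ Finset.Icc 1 l, p i) :
    -- there are exactly `F(l)` groups of order `n` up to isomorphism
    Nat.card (GroupIsoClass.{u} n) = Nat.fib (l + 1) ∧
    -- every group of order `n` is given by a chain of cyclic factors
    (∀ (G : Type u) [Group G], Nat.card G = n →
      ∃ c : CyclicChain l p, Nonempty (G ≃* c.toGroup)) ∧
    -- every chain gives a group of order `n`
    (∀ c : CyclicChain l p, Nat.card c.toGroup = n) ∧
    -- every admissible pattern of joins occurs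
    (∀ I : Finset ℕ, IsJoinPattern l I → ∃ c : CyclicChain l p, c.semi = I) ∧
    -- the isomorphism type is determined by the pattern of joins, and determines it
    (∀ c d : CyclicChain l p, Nonempty (c.toGroup ≃* d.toGroup) ↔ c.semi = d.semi) := by
  subst hn
  exact ⟨hp.card_groupIsoClass, fun G _ hG => exists_mulEquiv_cyclicChain hp hG,
    fun c => c.card_toGroup, fun I hI => hp.exists_cyclicChain hI, hp.nonempty_mulEquiv_iff⟩
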